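/- Let $A$ be a nonsingular $n\times n$ real or complex matrix whose rows and columns are partitioned by the same scheme $\mathcal I$ into $n_t$ consecutive nonempty blocks, and let $n_b$ be the largest block size. Let $A=LR$ be a block LU factorization: $L$ is block lower triangular and $R$ is block upper triangular with respect to $\mathcal I$. For $1\le p\le\infty$ let $\|\cdot\|_p$ be the Schatten $p$-norm (the $\ell^p$ norm of the vector of singular values), and let $\kappa_p(A)=\|A\|_p\|A^{-1}\|_p$. For $1\le k\le n_t$ let $$A^{(k)}=A_{k:n_t,\,k:n_t}-A_{k:n_t,\,1:k-1}\,(A_{1:k-1,\,1:k-1})^{-1}A_{1:k-1,\,k:n_t}$$ be the Schur complement of the first $k-1$ blocks (block indices; $A^{(1)}=A$), and let $$\rho_p=\frac{\max_{1\le k\le n_t}\|A^{(k)}\|_p}{\|A\|_p}$$ be the block growth factor. If the diagonal blocks of $L$ are unitary, then $$\|L\|_p\le n_b^{1/p}n_t+n_t\,\rho_p\,\kappa_p(A)\qquad\text{and}\qquad \|R\|_p\le n_t\,\rho_p\,\|A\|_p,$$ where $n_b^{1/p}=1$ for $p=\infty$ (the spectral norm). Thus $$\|L\|_p\|R\|_p\le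 n_t^2\,\rho_p^2\,\kappa_p(A)\,\|A\|_p+n_b^{1/p}n_t^2\,\rho_p\,\|A\|_p,$$ which is quadratic in the block growth factor. Analogously, if the diagonal blocks of $R$ are unitary instead, then $$\|R\|_p\le n_b^{1/p}n_t+n_t\,\rho_p\,\kappa_p(A)\qquad\text{and}\qquad\|L\|_p\le n_t\,\rho_p\,\|A\|_p,$$ and the same bound for $\|L\|_p\|R\|_p$ holds. -/

import Mathlib

open scoped ENNReal

noncomputable section

namespace BlockLU

variable {𝕜 : Type*} [RCLike 𝕜]

/-- The Schatten `p`-norm of a matrix: the `ℓ^p` norm of the vector of its singular values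
(the largest singular value if `p = ∞`). -/
def schattenNorm {m n : Type*} [Fintype m] [Fintype n] [DecidableEq n]
    (p : ℝ≥0∞) (M : Matrix m n 𝕜) : ℝ :=
  ‖(WithLp.toLp p fun i : Fin (Fintype.card n) =>
      (Matrix.toEuclideanLin M).singularValues (i : ℕ) : PiLp p fun _ => ℝ)‖

/-- The condition number `‖A‖ ‖A⁻¹‖` of a nonsingular matrix in the Schatten `p`-norm. -/
def schattenCond {n : Type*} [Fintype n] [DecidableEq n] (p : ℝ≥0∞) (A : Matrix n n 𝕜) : ℝ :=
  schattenNorm p A * schattenNorm p A⁻¹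

/-! A blocking scheme of `{0, …, n - 1}` is a composition `c` of `n`: it has `c.length`
consecutive nonempty blocks, the `k`-th of size `c.blocksFun k`, and the index `i` lies in the
block `c.index i`. -/

variable {n : ℕ}

/-- The largest block size. -/
def maxBlockSize (c : Composition n) : ℕ :=
  Finset.univ.sup c.blocksFun

/-- The Schur complement of the leading principal submatrix made of the blocks before `k`, that
is, the matrix that remains when these blocks have been eliminated. For `k = 0` it is `A`. -/
def schurComplement (c : Composition n) (A : Matrix (Fin n) (Fin n) 𝕜) (k : Fin c.length) :
    Matrix {i // k ≤ c.index i} {i // k ≤ c.index i} 𝕜 :=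
  A.toBlock (fun i => k ≤ c.index i) (fun i => k ≤ c.index i) -
    A.toBlock (fun i => k ≤ c.index i) (fun i => c.index i < k) *
      (A.toBlock (fun i => c.index i < k) (fun i => c.index i < k))⁻¹ *
      A.toBlock (fun i => c.index i < k) (fun i => k ≤ c.index i)

/-- The block growth factor: the largest norm of the successive Schur complements, divided by
the norm of the matrix. -/
def growthFactor (c : Composition n) (p : ℝ≥0∞) (A : Matrix (Fin n) (Fin n) 𝕜) : ℝ :=
  (⨆ k : Fin c.length, schattenNorm p (schurComplement c A k)) / schattenNorm p A

/-- `A = L R` is a block LU factorization: `L` is block lower triangular and `R` is block upper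
triangular. -/
structure IsBlockLU (c : Composition n) (A L R : Matrix (Fin n) (Fin n) 𝕜) : Prop where
  eq_mul : A = L * R
  lower : ∀ i j, c.index i < c.index j → L i j = 0
  upper : ∀ i j, c.index j < c.index i → R i j = 0

/-- Every diagonal block of `M` is unitary. -/
def HasUnitaryDiagBlocks (c : Composition n) (M : Matrix (Fin n) (Fin n) 𝕜) : Prop :=
  ∀ k : Fin c.length,
    M.toSquareBlock c.index k ∈ Matrix.unitaryGroup {i // c.index i = k} 𝕜

end BlockLU

end

/-! Let `E` and `P` be the coordinate projections onto block `k` and onto the blocks from `k` on.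
Triangularity makes the `k`-th Schur complement the product of the trailing parts of `L` and `R`, so
padded with zeros it is `P L P R P` (`schur_mul`). In its block row `k` only the diagonal block `U =
E L E` of `L` acts, and `Uᴴ U = E`; hence `E R = Uᴴ (P L P R P)` has norm at most `ρ ‖A‖`
(`coordProj_mul_upper`). With `P` now projecting onto the blocks after `k`, the part of column `k`
of `L` below the diagonal is `-(P L P R P) A⁻¹ U`, of norm at most `ρ ‖A‖ ‖A⁻¹‖`
(`lower_mul_coordProj`), and `U` itself contributes at most `n_b^{1/p}`. Summing over the blocks
gives the factor `n_t`. Conjugate transposition exchanges the roles of `L` and `R`.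

The norm facts needed come from one variational principle: `‖M‖_p` is the largest `ℓ^p` norm of `(⟨v
i, M (u i)⟩)` over Bessel families `u`, `v`. In terms of a singular value decomposition these
coefficients are dominated by a doubly substochastic matrix applied to the singular values. Bessel
families, unlike orthonormal ones, are stable under contractions and may contain zero vectors. -/

noncomputable section

namespace BlockLU

/-! ### Bessel families and singular values -/

section Analysis

variable {𝕜 : Type*} [RCLike 𝕜]
  {E : Type*} [NormedAddCommGroup E] [InnerProductSpace 𝕜 E]
  {F : Type*} [NormedAddCommGroup F] [InnerProductSpace 𝕜 F]
  {ι κ : Type*} [Fintype ι] [Fintype κ]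

open scoped InnerProductSpace

/-- A nonnegative matrix whose row and column sums are at most one is a contraction of `ℓ^p`. -/
theorem norm_toLp_le_of_substochastic {p : ℝ≥0∞} (hp : 1 ≤ p) {D : ι → κ → ℝ}
    (hD : ∀ i j, 0 ≤ D i j) (hrow : ∀ i, ∑ j, D i j ≤ 1) (hcol : ∀ j, ∑ i, D i j ≤ 1)
    {s : κ → ℝ} (hs : ∀ j, 0 ≤ s j) {z : ι → 𝕜} (hz : ∀ i, ‖z i‖ ≤ ∑ j, D i j * s j) :
    ‖(WithLp.toLp p z : PiLp p fun _ => 𝕜)‖ ≤ ‖(WithLp.toLp p s : PiLp p fun _ => ℝ)‖ := by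
  rcases eq_or_ne p ∞ with rfl | hp'
  · rw [PiLp.norm_eq_ciSup, PiLp.norm_eq_ciSup]
    refine Real.iSup_le (fun i => ?_) (Real.iSup_nonneg fun _ => norm_nonneg _)
    have hb : ∀ j, s j ≤ ⨆ j, ‖s j‖ := fun j =>
      (le_abs_self _).trans (le_ciSup (f := fun j => ‖s j‖) (Set.finite_range _).bddAbove j)
    calc ‖z i‖ ≤ ∑ j, D i j * s j := hz i
      _ ≤ ∑ j, D i j * ⨆ j, ‖s j‖ :=
        Finset.sum_le_sum fun j _ => mul_le_mul_of_nonneg_left (hb j) (hD i j)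
      _ = (∑ j, D i j) * ⨆ j, ‖s j‖ := (Finset.sum_mul ..).symm
      _ ≤ ⨆ j, ‖s j‖ :=
        mul_le_of_le_one_left (Real.iSup_nonneg fun _ => norm_nonneg _) (hrow i)
  · have hq : 1 ≤ p.toReal := by
      simpa using (ENNReal.toReal_le_toReal (by simp) hp').2 hp
    have hq0 : 0 < p.toReal := by linarith
    rw [PiLp.norm_eq_sum hq0, PiLp.norm_eq_sum hq0]
    refine Real.rpow_le_rpow (Finset.sum_nonneg fun _ _ => by positivity) ?_ (by positivity)
    have key : ∀ i, ‖z i‖ ^ p.toReal ≤ ∑ j, D i j * s j ^ p.toReal := by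
      intro i
      have hS : 0 ≤ ∑ j, D i j * s j ^ p.toReal :=
        Finset.sum_nonneg fun j _ => mul_nonneg (hD i j) (Real.rpow_nonneg (hs j) _)
      have h1 : ‖z i‖ ≤ (∑ j, D i j * s j ^ p.toReal) ^ (p.toReal)⁻¹ := by
        -- Weighted Hölder inequality; the factor `(∑ j, D i j) ^ (1 - 1/q)` is at most one by the
        -- row sum.
        refine (hz i).trans ((Real.inner_le_weight_mul_Lp_of_nonneg _ hq _ _ (hD i) hs).trans ?_)
        refine mul_le_of_le_one_left (Real.rpow_nonneg hS _) ?_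
        exact Real.rpow_le_one (Finset.sum_nonneg fun j _ => hD i j) (hrow i)
          (sub_nonneg.2 (inv_le_one_of_one_le₀ hq))
      calc ‖z i‖ ^ p.toReal ≤ ((∑ j, D i j * s j ^ p.toReal) ^ (p.toReal)⁻¹) ^ p.toReal := by
            gcongr
        _ = _ := Real.rpow_inv_rpow hS hq0.ne'
    calc ∑ i, ‖z i‖ ^ p.toReal ≤ ∑ i, ∑ j, D i j * s j ^ p.toReal :=
          Finset.sum_le_sum fun i _ => key i
      _ = ∑ j, (∑ i, D i j) * s j ^ p.toReal := by
          rw [Finset.sum_comm]; simp_rw [Finset.sum_mul]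
      _ ≤ ∑ j, ‖s j‖ ^ p.toReal := by
          refine Finset.sum_le_sum fun j _ => ?_
          rw [Real.norm_of_nonneg (hs j)]
          exact mul_le_of_le_one_left (Real.rpow_nonneg (hs j) _) (hcol j)

variable (𝕜) in
/-- A family of vectors that satisfies Bessel's inequality. -/
def IsBessel (b : ι → E) : Prop :=
  ∀ x, ∑ j, ‖⟪b j, x⟫_𝕜‖ ^ 2 ≤ ‖x‖ ^ 2

theorem _root_.Orthonormal.isBessel {b : ι → E} (hb : Orthonormal 𝕜 b) : IsBessel 𝕜 b :=
  fun x => hb.sum_inner_products_le x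

/-- Testing the Bessel inequality at `b j` itself gives `‖b j‖⁴ ≤ ‖b j‖²`. -/
theorem IsBessel.norm_le_one {b : ι → E} (hb : IsBessel 𝕜 b) (j : ι) : ‖b j‖ ≤ 1 := by
  have h := (Finset.single_le_sum (f := fun j' => ‖⟪b j', b j⟫_𝕜‖ ^ 2)
    (fun _ _ => by positivity) (Finset.mem_univ j)).trans (hb (b j))
  simp only [inner_self_eq_norm_sq_to_K, norm_pow, RCLike.norm_ofReal, abs_norm] at h
  by_contra! hlt
  nlinarith [one_lt_pow₀ hlt two_ne_zero]

/-- The absolute row sums of the products of the coefficients of two unit vectors with respect to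
two Bessel families are at most one. -/
theorem IsBessel.sum_mul_le_one {a : ι → E} {b : ι → F} (ha : IsBessel 𝕜 a) (hb : IsBessel 𝕜 b)
    {x : E} {y : F} (hx : ‖x‖ ≤ 1) (hy : ‖y‖ ≤ 1) :
    ∑ j, ‖⟪a j, x⟫_𝕜‖ * ‖⟪b j, y⟫_𝕜‖ ≤ 1 := by
  have h1 : ∑ j, ‖⟪a j, x⟫_𝕜‖ ^ 2 ≤ 1 := (ha x).trans (pow_le_one₀ (norm_nonneg _) hx)
  have h2 : ∑ j, ‖⟪b j, y⟫_𝕜‖ ^ 2 ≤ 1 := (hb y).trans (pow_le_one₀ (norm_nonneg _) hy)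
  have h3 : ∑ j, 2 * (‖⟪a j, x⟫_𝕜‖ * ‖⟪b j, y⟫_𝕜‖) ≤
      ∑ j, (‖⟪a j, x⟫_𝕜‖ ^ 2 + ‖⟪b j, y⟫_𝕜‖ ^ 2) :=
    Finset.sum_le_sum fun j _ => by nlinarith [sq_nonneg (‖⟪a j, x⟫_𝕜‖ - ‖⟪b j, y⟫_𝕜‖)]
  rw [Finset.sum_add_distrib, ← Finset.mul_sum] at h3
  linarith

variable [FiniteDimensional 𝕜 E] [FiniteDimensional 𝕜 F]

/-- The image of a Bessel family under a contraction is a Bessel family. -/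
theorem IsBessel.map {b : ι → E} (hb : IsBessel 𝕜 b) {T : E →ₗ[𝕜] F}
    (hT : ∀ x, ‖T.adjoint x‖ ≤ ‖x‖) : IsBessel 𝕜 fun j => T (b j) := by
  intro x
  simp_rw [← LinearMap.adjoint_inner_right]
  exact (hb _).trans (pow_le_pow_left₀ (norm_nonneg _) (hT x) 2)

/-- The singular value decomposition of a linear map, with zero vectors at the zero singular
values. -/
theorem exists_singularValue_decomposition (T : E →ₗ[𝕜] F) {n : ℕ}
    (hn : Module.finrank 𝕜 E = n) :
    ∃ (a : Fin n → E) (b : Fin n → F), IsBessel 𝕜 a ∧ IsBessel 𝕜 b ∧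
      (∀ x, T x = ∑ j : Fin n, (((T.singularValues (j : ℕ) : ℝ) : 𝕜) * ⟪a j, x⟫_𝕜) • b j) ∧
      ∀ j : Fin n, ⟪b j, T (a j)⟫_𝕜 = ((T.singularValues (j : ℕ) : ℝ) : 𝕜) := by
  have hS := T.isSymmetric_adjoint_comp_self
  set e := hS.eigenvectorBasis hn with he
  set σ : Fin n → ℝ := fun j => T.singularValues (j : ℕ) with hσ
  have hsq : ∀ j, hS.eigenvalues hn j = σ j ^ 2 := fun j => (T.sq_singularValues_fin hn j).symm
  have hin : ∀ i j, ⟪T (e i), T (e j)⟫_𝕜 = if i = j then (σ j : 𝕜) ^ 2 else 0 := by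
    intro i j
    rw [← LinearMap.adjoint_inner_right]
    have : T.adjoint (T (e j)) = ((hS.eigenvalues hn j : ℝ) : 𝕜) • e j :=
      hS.apply_eigenvectorBasis hn j
    rw [this, inner_smul_right, e.inner_eq_ite, hsq]
    split_ifs <;> simp
  -- Since `0⁻¹ = 0`, `b j` vanishes where `σ j = 0`: the family is Bessel, though in general not
  -- orthonormal.
  let b : Fin n → F := fun j => ((σ j)⁻¹ : 𝕜) • T (e j)
  have hTb : ∀ j, T (e j) = (σ j : 𝕜) • b j := by
    intro j
    by_cases h : σ j = 0
    · have : ⟪T (e j), T (e j)⟫_𝕜 = 0 := by rw [hin]; simp [h]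
      rw [inner_self_eq_zero.1 this, h]; simp
    · have : (σ j : 𝕜) ≠ 0 := by exact_mod_cast h
      simp only [b]
      rw [smul_smul, mul_inv_cancel₀ this, one_smul]
  refine ⟨e, b, e.orthonormal.isBessel, ?_, ?_, ?_⟩
  · intro x
    have horth : Orthonormal 𝕜 fun j : {j // σ j ≠ 0} => b j := by
      rw [orthonormal_iff_ite]
      rintro ⟨i, hi⟩ ⟨j, hj⟩
      have hi' : (σ i : 𝕜) ≠ 0 := by exact_mod_cast hi
      have hj' : (σ j : 𝕜) ≠ 0 := by exact_mod_cast hj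
      simp only [b, inner_smul_left, inner_smul_right, hin, Subtype.mk.injEq]
      split_ifs with h
      · subst h
        simp only [map_inv₀, RCLike.conj_ofReal]
        field_simp
      · simp
    -- Zero vectors contribute nothing, which leaves an orthonormal subfamily.
    rw [← Finset.sum_filter_of_ne (p := fun j => σ j ≠ 0),
      Finset.sum_subtype _ (p := fun j => σ j ≠ 0) (by simp)]
    · exact horth.isBessel x
    · intro j _ h h0
      simp [b, h0] at h
  · intro x
    conv_lhs => rw [← e.sum_repr' x, map_sum]
    refine Finset.sum_congr rfl fun j _ => ?_
    rw [map_smul, hTb, smul_smul, mul_comm]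
  · intro j
    simp only [b, inner_smul_left, hin, if_true, map_inv₀, RCLike.conj_ofReal]
    by_cases h : σ j = 0
    · simp [h, show T.singularValues (j : ℕ) = 0 from h]
    · have : (σ j : 𝕜) ≠ 0 := by exact_mod_cast h
      field_simp
      rfl

/-- The diagonal coefficients of a linear map with respect to two Bessel families are dominated in
`ℓ^p` by the singular values. -/
theorem norm_toLp_inner_le_singularValues {p : ℝ≥0∞} (hp : 1 ≤ p) (T : E →ₗ[𝕜] F) {n : ℕ}
    (hn : Module.finrank 𝕜 E = n) {u : ι → E} {v : ι → F} (hu : IsBessel 𝕜 u)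
    (hv : IsBessel 𝕜 v) :
    ‖(WithLp.toLp p fun i => ⟪v i, T (u i)⟫_𝕜 : PiLp p fun _ => 𝕜)‖ ≤
      ‖(WithLp.toLp p fun i : Fin n => T.singularValues (i : ℕ) : PiLp p fun _ => ℝ)‖ := by
  obtain ⟨a, b, ha, hb, hT, -⟩ := exists_singularValue_decomposition T hn
  refine norm_toLp_le_of_substochastic hp
    (D := fun i j => ‖⟪a j, u i⟫_𝕜‖ * ‖⟪b j, v i⟫_𝕜‖) (fun i j => by positivity)
    (fun i => ha.sum_mul_le_one hb (hu.norm_le_one i) (hv.norm_le_one i)) (fun j => ?_)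
    (fun j => T.singularValues_nonneg _) (fun i => ?_)
  -- For the column sums the families change roles: `u`, `v` are the Bessel families and `a j`, `b
  -- j` the vectors being expanded.
  · simp_rw [fun i => norm_inner_symm (𝕜 := 𝕜) (a j) (u i),
      fun i => norm_inner_symm (𝕜 := 𝕜) (b j) (v i)]
    exact hu.sum_mul_le_one hv (ha.norm_le_one j) (hb.norm_le_one j)
  · rw [hT, inner_sum]
    refine (norm_sum_le _ _).trans (Finset.sum_le_sum fun j _ => le_of_eq ?_)
    rw [inner_smul_right, norm_mul, norm_mul, RCLike.norm_ofReal,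
      abs_of_nonneg (T.singularValues_nonneg _), norm_inner_symm (v i)]
    ring

/-- The `ℓ^p` norm depends only on the absolute values of the entries. -/
theorem norm_toLp_congr (p : ℝ≥0∞) (hp : 1 ≤ p) {s : ι → ℝ} {z : ι → 𝕜} (h : ∀ i, ‖z i‖ = ‖s i‖) :
    ‖(WithLp.toLp p z : PiLp p fun _ => 𝕜)‖ = ‖(WithLp.toLp p s : PiLp p fun _ => ℝ)‖ := by
  rcases eq_or_ne p ∞ with rfl | hp'
  · simp [PiLp.norm_eq_ciSup, h]
  · have hq0 : 0 < p.toReal := ENNReal.toReal_pos (by positivity) hp'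
    simp [PiLp.norm_eq_sum hq0, h]

end Analysis

/-! ### Schatten norms and contractions -/

section Schatten

open scoped InnerProductSpace Matrix

variable {𝕜 : Type*} [RCLike 𝕜]
  {l m n o : Type*} [Fintype l] [Fintype m] [Fintype n] [Fintype o]
  [DecidableEq n] {p : ℝ≥0∞}

theorem schattenNorm_nonneg (hp : 1 ≤ p) (M : Matrix m n 𝕜) : 0 ≤ schattenNorm p M :=
  have : Fact (1 ≤ p) := ⟨hp⟩
  norm_nonneg _

theorem norm_toLp_inner_le_schattenNorm (hp : 1 ≤ p) (M : Matrix m n 𝕜) {ι : Type*} [Fintype ι]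
    {u : ι → EuclideanSpace 𝕜 n} {v : ι → EuclideanSpace 𝕜 m} (hu : IsBessel 𝕜 u)
    (hv : IsBessel 𝕜 v) :
    ‖(WithLp.toLp p fun i => ⟪v i, M.toEuclideanLin (u i)⟫_𝕜 : PiLp p fun _ => 𝕜)‖ ≤
      schattenNorm p M :=
  norm_toLp_inner_le_singularValues hp _ finrank_euclideanSpace hu hv

/-- To bound a Schatten norm it suffices to bound the diagonal coefficients with respect to all
Bessel families. -/
theorem schattenNorm_le (hp : 1 ≤ p) {M : Matrix m n 𝕜} {C : ℝ}
    (h : ∀ (u : Fin (Fintype.card n) → EuclideanSpace 𝕜 n)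
      (v : Fin (Fintype.card n) → EuclideanSpace 𝕜 m), IsBessel 𝕜 u → IsBessel 𝕜 v →
      ‖(WithLp.toLp p fun i => ⟪v i, M.toEuclideanLin (u i)⟫_𝕜 : PiLp p fun _ => 𝕜)‖ ≤ C) :
    schattenNorm p M ≤ C := by
  obtain ⟨a, b, ha, hb, -, hab⟩ :=
    exists_singularValue_decomposition M.toEuclideanLin finrank_euclideanSpace
  refine le_trans (le_of_eq ?_) (h a b ha hb)
  refine (norm_toLp_congr p hp fun i => ?_).symm
  rw [hab, RCLike.norm_ofReal, Real.norm_eq_abs]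

/-- The coefficients `⟨v i, M (u i)⟩` are additive in `M`, so the triangle inequality of `ℓ^p`
carries over. -/
theorem schattenNorm_add_le (hp : 1 ≤ p) (M N : Matrix m n 𝕜) :
    schattenNorm p (M + N) ≤ schattenNorm p M + schattenNorm p N := by
  have : Fact (1 ≤ p) := ⟨hp⟩
  refine schattenNorm_le hp fun u v hu hv => ?_
  refine le_trans (le_of_eq ?_) ((norm_add_le _ _).trans (add_le_add
    (norm_toLp_inner_le_schattenNorm hp M hu hv) (norm_toLp_inner_le_schattenNorm hp N hu hv)))
  rw [← WithLp.toLp_add]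
  congr 2
  ext i
  simp [inner_add_right]

theorem schattenNorm_zero (hp : 1 ≤ p) : schattenNorm p (0 : Matrix m n 𝕜) = 0 := by
  have : Fact (1 ≤ p) := ⟨hp⟩
  refine le_antisymm (schattenNorm_le hp fun u v _ _ => le_of_eq ?_) (schattenNorm_nonneg hp _)
  simp only [map_zero, LinearMap.zero_apply, inner_zero_right]
  exact norm_zero (E := PiLp p fun _ : Fin (Fintype.card n) => 𝕜)

theorem schattenNorm_sum_le (hp : 1 ≤ p) {ι : Type*} (s : Finset ι) (M : ι → Matrix m n 𝕜) :
    schattenNorm p (∑ i ∈ s, M i) ≤ ∑ i ∈ s, schattenNorm p (M i) :=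
  Finset.le_sum_of_subadditive _ (schattenNorm_zero hp).le (schattenNorm_add_le hp) s M

theorem schattenNorm_smul_le (hp : 1 ≤ p) (a : 𝕜) (M : Matrix m n 𝕜) :
    schattenNorm p (a • M) ≤ ‖a‖ * schattenNorm p M := by
  have : Fact (1 ≤ p) := ⟨hp⟩
  refine schattenNorm_le hp fun u v hu hv => ?_
  refine le_trans (le_of_eq ?_) (mul_le_mul_of_nonneg_left
    (norm_toLp_inner_le_schattenNorm hp M hu hv) (norm_nonneg a))
  rw [← norm_smul, ← WithLp.toLp_smul]
  congr 2
  ext i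
  simp [inner_smul_right]

theorem schattenNorm_neg (hp : 1 ≤ p) (M : Matrix m n 𝕜) :
    schattenNorm p (-M) = schattenNorm p M := by
  have h : ∀ M : Matrix m n 𝕜, schattenNorm p (-M) ≤ schattenNorm p M := fun M => by
    simpa using schattenNorm_smul_le hp (-1) M
  exact le_antisymm (h M) (by simpa using h (-M))

/-- Taking adjoints swaps `u` and `v` and conjugates the coefficients, which keeps their absolute
values. -/
theorem schattenNorm_conjTranspose_le [DecidableEq m] (hp : 1 ≤ p) (M : Matrix m n 𝕜) :
    schattenNorm p Mᴴ ≤ schattenNorm p M := by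
  refine schattenNorm_le hp fun u v hu hv => ?_
  refine le_trans (le_of_eq ?_) (norm_toLp_inner_le_schattenNorm hp M hv hu)
  have h : ∀ i, ‖⟪v i, Mᴴ.toEuclideanLin (u i)⟫_𝕜‖ = ‖‖⟪u i, M.toEuclideanLin (v i)⟫_𝕜‖‖ := by
    intro i
    rw [Matrix.toEuclideanLin_conjTranspose_eq_adjoint, LinearMap.adjoint_inner_right,
      norm_inner_symm, norm_norm]
  exact (norm_toLp_congr p hp h).trans (norm_toLp_congr p hp fun i => (norm_norm _).symm).symm

@[simp]
theorem schattenNorm_conjTranspose [DecidableEq m] (hp : 1 ≤ p) (M : Matrix m n 𝕜) :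
    schattenNorm p Mᴴ = schattenNorm p M :=
  le_antisymm (schattenNorm_conjTranspose_le hp M)
    (by simpa using schattenNorm_conjTranspose_le hp Mᴴ)

omit [DecidableEq n] in
theorem norm_inner_self_eq_sq (x : EuclideanSpace 𝕜 n) : ‖⟪x, x⟫_𝕜‖ = ‖x‖ ^ 2 := by
  simp [inner_self_eq_norm_sq_to_K]

/-- The operator norm is dominated by every Schatten norm. -/
theorem norm_toEuclideanLin_le_schattenNorm (hp : 1 ≤ p) (M : Matrix m n 𝕜)
    (x : EuclideanSpace 𝕜 n) : ‖M.toEuclideanLin x‖ ≤ schattenNorm p M * ‖x‖ := by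
  have : Fact (1 ≤ p) := ⟨hp⟩
  set y := M.toEuclideanLin x with hy
  by_cases hx0 : x = 0
  · simp [hy, hx0]
  by_cases hy0 : y = 0
  · rw [hy0, norm_zero]
    exact mul_nonneg (schattenNorm_nonneg hp M) (norm_nonneg x)
  have hx : ‖x‖ ≠ 0 := norm_ne_zero_iff.2 hx0
  have hy' : ‖y‖ ≠ 0 := norm_ne_zero_iff.2 hy0
  -- One-element families, the normalized `x` and `M x`, have the single coefficient `‖M x‖ / ‖x‖`.
  have hu : Orthonormal 𝕜 fun _ : Unit => ((‖x‖⁻¹ : ℝ) : 𝕜) • x :=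
    ⟨fun _ => by rw [norm_smul, RCLike.norm_ofReal, abs_inv, abs_norm, inv_mul_cancel₀ hx],
      fun _ _ h => (h rfl).elim⟩
  have hv : Orthonormal 𝕜 fun _ : Unit => ((‖y‖⁻¹ : ℝ) : 𝕜) • y :=
    ⟨fun _ => by rw [norm_smul, RCLike.norm_ofReal, abs_inv, abs_norm, inv_mul_cancel₀ hy'],
      fun _ _ h => (h rfl).elim⟩
  have h := (PiLp.norm_apply_le _ ()).trans
    (norm_toLp_inner_le_schattenNorm hp M hu.isBessel hv.isBessel)
  have h2 : ‖⟪((‖y‖⁻¹ : ℝ) : 𝕜) • y, M.toEuclideanLin (((‖x‖⁻¹ : ℝ) : 𝕜) • x)⟫_𝕜‖ =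
      ‖y‖ / ‖x‖ := by
    rw [map_smul, ← hy, inner_smul_left, inner_smul_right, inner_self_eq_norm_sq_to_K]
    simp
    field_simp
  simp only [h2] at h
  rwa [div_le_iff₀ (by positivity)] at h

/-- A matrix of spectral norm at most one. -/
def IsContraction (M : Matrix m n 𝕜) : Prop :=
  ∀ x, ‖M.toEuclideanLin x‖ ≤ ‖x‖

omit [Fintype l] in
theorem toEuclideanLin_mul_apply [DecidableEq m] (M : Matrix l m 𝕜) (N : Matrix m n 𝕜)
    (x : EuclideanSpace 𝕜 n) :
    (M * N).toEuclideanLin x = M.toEuclideanLin (N.toEuclideanLin x) := by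
  simp [Matrix.toLpLin_apply, Matrix.mulVec_mulVec]

theorem IsContraction.mul [DecidableEq m] {M : Matrix l m 𝕜} {N : Matrix m n 𝕜} (hM : IsContraction M)
    (hN : IsContraction N) : IsContraction (M * N) := fun x => by
  rw [toEuclideanLin_mul_apply]
  exact (hM _).trans (hN x)

theorem IsContraction.conjTranspose [DecidableEq m] {M : Matrix m n 𝕜} (hM : IsContraction M) :
    IsContraction Mᴴ := fun x => by
  have h : ‖Mᴴ.toEuclideanLin x‖ ^ 2 ≤ ‖Mᴴ.toEuclideanLin x‖ * ‖x‖ := by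
    rw [← norm_inner_self_eq_sq]
    nth_rw 2 [Matrix.toEuclideanLin_conjTranspose_eq_adjoint]
    rw [LinearMap.adjoint_inner_right]
    exact (norm_inner_le_norm _ _).trans (mul_le_mul_of_nonneg_right (hM _) (norm_nonneg _))
  rcases (norm_nonneg (Mᴴ.toEuclideanLin x)).eq_or_lt with h0 | h0
  · rw [← h0]; exact norm_nonneg x
  · rw [sq] at h; exact le_of_mul_le_mul_left h h0

/-- A matrix with orthonormal columns is a contraction. -/
theorem isContraction_of_conjTranspose_mul_self [DecidableEq m] {M : Matrix m n 𝕜} (h : Mᴴ * M = 1) :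
    IsContraction M := fun x => by
  refine le_of_eq ?_
  have : ‖M.toEuclideanLin x‖ ^ 2 = ‖x‖ ^ 2 := by
    rw [← norm_inner_self_eq_sq, ← norm_inner_self_eq_sq x,
      ← LinearMap.adjoint_inner_right, ← Matrix.toEuclideanLin_conjTranspose_eq_adjoint,
      ← toEuclideanLin_mul_apply, h]
    simp
  exact (pow_left_inj₀ (norm_nonneg _) (norm_nonneg _) two_ne_zero).1 this

theorem IsContraction.adjoint_le [DecidableEq m] {M : Matrix m n 𝕜} (hM : IsContraction M)
    (x : EuclideanSpace 𝕜 m) : ‖M.toEuclideanLin.adjoint x‖ ≤ ‖x‖ := by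
  rw [← Matrix.toEuclideanLin_conjTranspose_eq_adjoint]
  exact hM.conjTranspose x

/-- Multiplication by contractions does not increase a Schatten norm. -/
theorem schattenNorm_mul_mul_le [DecidableEq l] [DecidableEq m] [DecidableEq o] (hp : 1 ≤ p) {X : Matrix l m 𝕜} (M : Matrix m n 𝕜)
    {Y : Matrix n o 𝕜} (hX : IsContraction X) (hY : IsContraction Y) :
    schattenNorm p (X * M * Y) ≤ schattenNorm p M := by
  refine schattenNorm_le hp fun u v hu hv => ?_
  -- `⟨v, X M Y u⟩ = ⟨Xᴴ v, M (Y u)⟩`, and contractions preserve Bessel families.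
  have hv' := hv.map (T := Xᴴ.toEuclideanLin) hX.conjTranspose.adjoint_le
  have hu' := hu.map (T := Y.toEuclideanLin) hY.adjoint_le
  refine le_trans (le_of_eq ?_) (norm_toLp_inner_le_schattenNorm hp M hu' hv')
  congr 2
  ext i
  rw [Matrix.toEuclideanLin_conjTranspose_eq_adjoint, LinearMap.adjoint_inner_left,
    toEuclideanLin_mul_apply, toEuclideanLin_mul_apply]

/-- A Schatten norm of a product is at most the Schatten norm of the first factor times a bound of
the spectral norm of the second. -/
theorem schattenNorm_mul_le [DecidableEq l] [DecidableEq m] (hp : 1 ≤ p) (M : Matrix l m 𝕜) {N : Matrix m n 𝕜} {c : ℝ}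
    (hc : 0 ≤ c) (hN : ∀ x, ‖N.toEuclideanLin x‖ ≤ c * ‖x‖) :
    schattenNorm p (M * N) ≤ schattenNorm p M * c := by
  rcases hc.eq_or_lt with rfl | hc
  · have : N = 0 := by
      apply Matrix.toEuclideanLin.injective
      ext1 x
      simpa using hN x
    rw [this, Matrix.mul_zero, schattenNorm_zero hp, mul_zero]
  · have hc' : (c : 𝕜) ≠ 0 := by exact_mod_cast hc.ne'
    have hY : IsContraction ((c : 𝕜)⁻¹ • N) := fun x => by
      rw [map_smul, LinearMap.smul_apply, norm_smul, norm_inv, RCLike.norm_ofReal,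
        abs_of_pos hc, inv_mul_le_iff₀ hc]
      exact hN x
    have hX : IsContraction (1 : Matrix l l 𝕜) :=
      isContraction_of_conjTranspose_mul_self (by simp)
    have h : M * N = (c : 𝕜) • ((1 : Matrix l l 𝕜) * M * ((c : 𝕜)⁻¹ • N)) := by
      rw [Matrix.one_mul, Matrix.mul_smul, smul_smul, mul_inv_cancel₀ hc', one_smul]
    rw [h, mul_comm]
    refine (schattenNorm_smul_le hp _ _).trans ?_
    rw [RCLike.norm_ofReal, abs_of_pos hc]
    exact mul_le_mul_of_nonneg_left (schattenNorm_mul_mul_le hp M hX hY) hc.le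

/-- The Schatten norm of a contraction. -/
theorem IsContraction.schattenNorm_le (hp : 1 ≤ p) {M : Matrix m n 𝕜} (hM : IsContraction M) :
    schattenNorm p M ≤ (Fintype.card n : ℝ) ^ (1 / p).toReal := by
  have hs : ∀ i : Fin (Fintype.card n), ‖M.toEuclideanLin.singularValues (i : ℕ)‖ ≤ 1 := by
    obtain ⟨a, b, ha, hb, -, hab⟩ :=
      exists_singularValue_decomposition M.toEuclideanLin finrank_euclideanSpace
    intro i
    have h := norm_inner_le_norm (𝕜 := 𝕜) (b i) (M.toEuclideanLin (a i))
    rw [hab, RCLike.norm_ofReal] at h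
    exact h.trans (mul_le_one₀ (hb.norm_le_one i) (norm_nonneg _)
      ((hM _).trans (ha.norm_le_one i)))
  rcases eq_or_ne p ∞ with rfl | hp'
  -- Here `(1 / ∞).toReal = 0`, so the bound is one, also when the index type is empty.
  · simpa [schattenNorm, PiLp.norm_eq_ciSup] using Real.iSup_le hs zero_le_one
  · have hq0 : 0 < p.toReal := ENNReal.toReal_pos (by positivity) hp'
    rw [schattenNorm, PiLp.norm_eq_sum hq0, ENNReal.toReal_div, ENNReal.toReal_one]
    refine Real.rpow_le_rpow (Finset.sum_nonneg fun _ _ => by positivity) ?_ (by positivity)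
    refine (Finset.sum_le_sum fun i _ =>
      Real.rpow_le_one (norm_nonneg _) (hs i) hq0.le).trans ?_
    simp

end Schatten

/-! ### Block triangular matrices and Schur complements -/

section Blocks

open scoped Matrix

variable {𝕜 : Type*} [RCLike 𝕜] {m α : Type*} [Fintype m] [DecidableEq m] [LinearOrder α]

omit [DecidableEq m] in
theorem toBlock_mul_split (b : m → α) (k : α) (p q : m → Prop) (M N : Matrix m m 𝕜) :
    (M * N).toBlock p q =
      M.toBlock p (fun i => b i < k) * N.toBlock (fun i => b i < k) q +
        M.toBlock p (fun i => k ≤ b i) * N.toBlock (fun i => k ≤ b i) q := by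
  -- The predicate `r` is generalized because `k ≤ b i` and `¬ b i < k` occur in the index types,
  -- where they cannot be interchanged directly.
  have key : ∀ (r : m → Prop) [DecidablePred r], r = (fun i => ¬ b i < k) →
      (M * N).toBlock p q =
        M.toBlock p (fun i => b i < k) * N.toBlock (fun i => b i < k) q +
          M.toBlock p r * N.toBlock r q := by
    rintro r _ rfl
    convert Matrix.toBlock_mul_eq_add p (fun i => b i < k) q M N
  exact key _ (by simp only [not_lt])

/-- The columns of the identity matrix whose indices satisfy `p`. -/
def selection (𝕜 : Type*) [RCLike 𝕜] (p : m → Prop) : Matrix m {i // p i} 𝕜 :=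
  (1 : Matrix m m 𝕜).submatrix id Subtype.val

theorem mul_selection (p : m → Prop) {l : Type*} (M : Matrix l m 𝕜) :
    M * selection 𝕜 p = M.submatrix id Subtype.val := by
  ext i j
  simp [selection, Matrix.mul_apply, Matrix.one_apply]

theorem conjTranspose_selection_mul (p : m → Prop) {l : Type*} (M : Matrix m l 𝕜) :
    (selection 𝕜 p)ᴴ * M = M.submatrix Subtype.val id := by
  ext i j
  simp [selection, Matrix.mul_apply, Matrix.one_apply]

theorem conjTranspose_selection_mul_mul_selection (p q : m → Prop) (M : Matrix m m 𝕜) :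
    (selection 𝕜 p)ᴴ * M * selection 𝕜 q = M.toBlock p q := by
  rw [mul_selection, conjTranspose_selection_mul]
  rfl

theorem conjTranspose_selection_mul_selection (p : m → Prop) :
    (selection 𝕜 p)ᴴ * selection 𝕜 p = 1 := by
  rw [conjTranspose_selection_mul, selection]
  ext i j
  simp [Matrix.one_apply, Subtype.ext_iff]

/-- Together with the previous identity this turns restriction to blocks and padding with zeros into
multiplications by contractions, so that Schur complements of different sizes are compared inside
matrices of full size. -/
theorem selection_mul_conjTranspose_selection (p : m → Prop) [DecidablePred p] :
    selection 𝕜 p * (selection 𝕜 p)ᴴ = Matrix.diagonal fun i => if p i then 1 else 0 := by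
  ext i j
  rw [Matrix.mul_apply]
  simp only [selection, Matrix.submatrix_apply, Matrix.conjTranspose_apply, id,
    Matrix.one_apply, apply_ite star, star_one, star_zero, mul_ite, mul_one, mul_zero]
  by_cases hi : p j
  · rw [Finset.sum_eq_single ⟨j, hi⟩]
    · by_cases h : i = j
      · subst h; simp [hi]
      · simp [h]
    · rintro ⟨x, hx⟩ - h
      replace h : x ≠ j := fun e => h (Subtype.ext e)
      simp [Ne.symm h]
    · simp
  · rw [Finset.sum_eq_zero]
    · by_cases h : i = j
      · subst h; simp [hi]
      · simp [h]
    · rintro ⟨x, hx⟩ -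
      rw [if_neg]
      rintro rfl
      exact hi hx

theorem isContraction_selection (p : m → Prop) [DecidablePred p] :
    IsContraction (selection 𝕜 p) :=
  isContraction_of_conjTranspose_mul_self (conjTranspose_selection_mul_selection p)

/-- The orthogonal projection onto the coordinates that satisfy `p`. -/
def coordProj (𝕜 : Type*) [RCLike 𝕜] (p : m → Prop) [DecidablePred p] : Matrix m m 𝕜 :=
  Matrix.diagonal fun i => if p i then 1 else 0

theorem coordProj_mul_apply (p : m → Prop) [DecidablePred p] (M : Matrix m m 𝕜) (i j : m) :
    (coordProj 𝕜 p * M) i j = if p i then M i j else 0 := by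
  simp [coordProj]

theorem mul_coordProj_apply (p : m → Prop) [DecidablePred p] (M : Matrix m m 𝕜) (i j : m) :
    (M * coordProj 𝕜 p) i j = if p j then M i j else 0 := by
  simp [coordProj]

theorem coordProj_mul_self (p : m → Prop) [DecidablePred p] :
    coordProj 𝕜 p * coordProj 𝕜 p = coordProj 𝕜 p := by
  simp [coordProj]

theorem coordProj_mul_eq_zero {p q : m → Prop} [DecidablePred p] [DecidablePred q]
    (h : ∀ i, p i → ¬ q i) : coordProj 𝕜 p * coordProj 𝕜 q = 0 := by
  ext i j
  rw [coordProj_mul_apply, coordProj]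
  by_cases hij : i = j
  · subst hij
    by_cases hp : p i <;> simp [hp, h]
  · simp [hij]

variable {b : m → α} {A L R : Matrix m m 𝕜}

theorem blockLower_inv (hL : IsUnit L) (h : ∀ i j, b i < b j → L i j = 0) :
    ∀ i j, b i < b j → L⁻¹ i j = 0 := by
  intro i j hij
  have hT : Lᵀ.BlockTriangular b := fun i j hij => h j i hij
  have : Invertible Lᵀ := ((Matrix.isUnit_transpose L).2 hL).invertible
  have h2 := Matrix.blockTriangular_inv_of_blockTriangular hT hij
  rwa [← Matrix.transpose_nonsing_inv, Matrix.transpose_apply] at h2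

theorem blockUpper_inv (hR : IsUnit R) (h : ∀ i j, b j < b i → R i j = 0) :
    ∀ i j, b j < b i → R⁻¹ i j = 0 := by
  have hT : R.BlockTriangular b := h
  have : Invertible R := hR.invertible
  exact Matrix.blockTriangular_inv_of_blockTriangular hT

/-- The Schur complement of a product of a block lower and a block upper triangular matrix is the
product of their trailing principal submatrices. -/
theorem schur_mul (hL : IsUnit L) (hR : IsUnit R) (hl : ∀ i j, b i < b j → L i j = 0)
    (hr : ∀ i j, b j < b i → R i j = 0) (k : α) :
    (L * R).toBlock (fun i => k ≤ b i) (fun i => k ≤ b i) -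
      (L * R).toBlock (fun i => k ≤ b i) (fun i => b i < k) *
        ((L * R).toBlock (fun i => b i < k) (fun i => b i < k))⁻¹ *
        (L * R).toBlock (fun i => b i < k) (fun i => k ≤ b i) =
    L.toBlock (fun i => k ≤ b i) (fun i => k ≤ b i) *
      R.toBlock (fun i => k ≤ b i) (fun i => k ≤ b i) := by
  have hl0 : ∀ {M : Matrix m m 𝕜}, (∀ i j, b i < b j → M i j = 0) →
      M.toBlock (fun i => b i < k) (fun i => k ≤ b i) = 0 := by
    intro M hM
    ext ⟨i, hi⟩ ⟨j, hj⟩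
    exact hM i j (hi.trans_le hj)
  have hr0 : ∀ {M : Matrix m m 𝕜}, (∀ i j, b j < b i → M i j = 0) →
      M.toBlock (fun i => k ≤ b i) (fun i => b i < k) = 0 := by
    intro M hM
    ext ⟨i, hi⟩ ⟨j, hj⟩
    exact hM i j (hj.trans_le hi)
  -- The leading part of `L L⁻¹ = 1` contains no trailing term, so the leading part of `L⁻¹` is a
  -- right inverse.
  have hL1 : IsUnit (L.toBlock (fun i => b i < k) (fun i => b i < k)).det := by
    have h := toBlock_mul_split b k (fun i => b i < k) (fun i => b i < k) L L⁻¹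
    rw [Matrix.mul_nonsing_inv _ ((Matrix.isUnit_iff_isUnit_det L).1 hL),
      Matrix.toBlock_one_self, hl0 hl, Matrix.zero_mul, add_zero] at h
    exact Matrix.isUnit_det_of_right_inverse h.symm
  -- For `R` the trailing term disappears because `R⁻¹` is block upper triangular.
  have hR1 : IsUnit (R.toBlock (fun i => b i < k) (fun i => b i < k)).det := by
    have h := toBlock_mul_split b k (fun i => b i < k) (fun i => b i < k) R R⁻¹
    rw [Matrix.mul_nonsing_inv _ ((Matrix.isUnit_iff_isUnit_det R).1 hR),
      Matrix.toBlock_one_self, hr0 (blockUpper_inv hR hr), Matrix.mul_zero, add_zero] at h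
    exact Matrix.isUnit_det_of_right_inverse h.symm
  -- With 1 for leading and 2 for trailing: `A₂₂ = L₂₁ R₁₂ + L₂₂ R₂₂`, and `(L₂₁ R₁₁) (L₁₁ R₁₁)⁻¹
  -- (L₁₁ R₁₂) = L₂₁ R₁₂` cancels the first term.
  simp only [toBlock_mul_split b k _ _ L R, hl0 hl, hr0 hr, Matrix.zero_mul, Matrix.mul_zero,
    add_zero]
  rw [Matrix.mul_inv_rev, ← Matrix.mul_assoc, ← Matrix.mul_assoc (_ * _) _⁻¹ _⁻¹,
    Matrix.mul_nonsing_inv_cancel_right _ _ hR1, Matrix.nonsing_inv_mul_cancel_right _ _ hL1, add_sub_cancel_left]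

/-- A block row of the upper triangular factor in terms of a trailing principal part of `L * R`. -/
theorem coordProj_mul_upper (hl : ∀ i j, b i < b j → L i j = 0)
    (hr : ∀ i j, b j < b i → R i j = 0) (k : α) {E P U : Matrix m m 𝕜}
    (hE : E = coordProj 𝕜 fun i => b i = k) (hP : P = coordProj 𝕜 fun i => k ≤ b i)
    (hU : U = E * L * E) (hUU : Uᴴ * U = E) :
    Uᴴ * (P * L * P * R * P) = E * R := by
  have hEP : E * P = E := by
    ext i j
    rw [hP, mul_coordProj_apply, hE, coordProj]
    by_cases hij : i = j
    · subst hij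
      by_cases h : b i = k <;> simp [h]
    · simp [hij]
  have hEE : E * E = E := by rw [hE, coordProj_mul_self]
  have hEH : Eᴴ = E := by
    rw [hE, coordProj, Matrix.diagonal_conjTranspose]
    congr 1
    ext i
    simp [apply_ite star]
  have hUE : Uᴴ = Uᴴ * E := by
    rw [hU, Matrix.conjTranspose_mul, Matrix.conjTranspose_mul, hEH]
    simp only [Matrix.mul_assoc, hEE]
  -- Block row `k` of `L` lives in columns up to `k`, and `P` keeps those from `k` on; only the
  -- diagonal block survives.
  have hEL : E * L * P = E * L * E := by
    ext i j
    simp only [hP, hE, mul_coordProj_apply, coordProj_mul_apply]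
    grind
  have hER : E * R * P = E * R := by
    ext i j
    simp only [hP, hE, mul_coordProj_apply, coordProj_mul_apply]
    grind
  calc Uᴴ * (P * L * P * R * P) = Uᴴ * E * (P * L * P * R * P) := by rw [← hUE]
    _ = Uᴴ * ((E * P) * L * P * R * P) := by simp only [Matrix.mul_assoc]
    _ = Uᴴ * (E * L * P * R * P) := by rw [hEP]
    _ = Uᴴ * (E * L * E * R * P) := by rw [hEL]
    _ = Uᴴ * (E * L * E * (E * R * P)) := by
      rw [← Matrix.mul_assoc (E * L * E), ← Matrix.mul_assoc (E * L * E), Matrix.mul_assoc _ E E,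
        hEE]
    _ = (Uᴴ * U) * (E * R * P) := by rw [← hU, ← Matrix.mul_assoc]
    _ = E * R := by rw [hUU, hER, ← Matrix.mul_assoc, hEE]

/-- The part of a block column of the lower triangular factor below the diagonal block, in terms of
a trailing principal part of `L * R` and the inverse of `L * R`. -/
theorem lower_mul_coordProj (hL : IsUnit L) (hR : IsUnit R) (hl : ∀ i j, b i < b j → L i j = 0)
    (hr : ∀ i j, b j < b i → R i j = 0) (k : α) {E P : Matrix m m 𝕜}
    (hE : E = coordProj 𝕜 fun i => b i = k) (hP : P = coordProj 𝕜 fun i => k < b i) :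
    L * E = E * L * E + -(P * L * P * R * P * (L * R)⁻¹ * (E * L * E)) := by
  have hPE : P * E = 0 := by
    rw [hP, hE]
    exact coordProj_mul_eq_zero fun i hi h => hi.ne' h
  have hPP : P * P = P := by rw [hP, coordProj_mul_self]
  have hPR : P * R * P = P * R := by
    ext i j
    simp only [hP, mul_coordProj_apply, coordProj_mul_apply]
    grind
  have hPL : P * L⁻¹ * P = L⁻¹ * P := by
    have := blockLower_inv hL hl
    ext i j
    simp only [hP, mul_coordProj_apply, coordProj_mul_apply]
    grind
  have hLE : L * E = E * L * E + P * L * E := by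
    ext i j
    simp only [hP, hE, mul_coordProj_apply, coordProj_mul_apply, Matrix.add_apply]
    grind
  have hL' := (Matrix.isUnit_iff_isUnit_det L).1 hL
  have hR' := (Matrix.isUnit_iff_isUnit_det R).1 hR
  have hELE : E * L * E = L * E - P * L * E := eq_sub_of_add_eq hLE.symm
  have key : P * L * P * R * P * (L * R)⁻¹ * (E * L * E) = -(P * L * E) := by
    calc P * L * P * R * P * (L * R)⁻¹ * (E * L * E)
        = P * L * (P * R * P) * (R⁻¹ * L⁻¹) * (E * L * E) := by
          rw [Matrix.mul_inv_rev]; simp only [Matrix.mul_assoc]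
      _ = P * L * P * (R * R⁻¹) * L⁻¹ * (E * L * E) := by
          rw [hPR]; simp only [Matrix.mul_assoc]
      _ = P * L * P * L⁻¹ * (L * E - P * L * E) := by
          rw [Matrix.mul_nonsing_inv _ hR', Matrix.mul_one, hELE]
      -- The first term vanishes by `P E = 0`; in the second, `P L⁻¹ P = L⁻¹ P` lets `L` cancel
      -- against `L⁻¹`.
      _ = P * L * (P * ((L⁻¹ * L) * E)) - P * L * (P * L⁻¹ * P) * L * E := by
          rw [Matrix.mul_sub]; simp only [Matrix.mul_assoc]
      _ = - (P * (L * L⁻¹) * P * L * E) := by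
          rw [Matrix.nonsing_inv_mul _ hL', Matrix.one_mul, hPE, Matrix.mul_zero, zero_sub, hPL]
          simp only [Matrix.mul_assoc]
      _ = -(P * L * E) := by rw [Matrix.mul_nonsing_inv _ hL', Matrix.mul_one, hPP]
  rw [key, neg_neg, ← hLE]

end Blocks

/-! ### Growth factor and the bounds for the factors -/

section Bounds

open scoped Matrix

variable {𝕜 : Type*} [RCLike 𝕜] {n : ℕ} {c : Composition n} {A L R : Matrix (Fin n) (Fin n) 𝕜}
  {p : ℝ≥0∞}

theorem card_block_le (c : Composition n) (k : Fin c.length) :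
    Fintype.card {i // c.index i = k} ≤ maxBlockSize c := by
  refine le_trans ?_ (Finset.le_sup (f := c.blocksFun) (Finset.mem_univ k))
  have h := Fintype.card_le_of_surjective
    (fun j : Fin (c.blocksFun k) =>
      (⟨c.embedding k j, c.index_embedding k j⟩ : {i // c.index i = k})) (by
      rintro ⟨i, rfl⟩
      exact ⟨c.invEmbedding i, Subtype.ext (c.embedding_comp_inv i)⟩)
  simpa using h

theorem sum_coordProj_index (c : Composition n) :
    ∑ k, coordProj 𝕜 (fun i => c.index i = k) = (1 : Matrix (Fin n) (Fin n) 𝕜) := by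
  ext i j
  rw [Matrix.sum_apply]
  by_cases hij : i = j
  · subst hij
    simp [coordProj]
  · simp [coordProj, hij]

/-- This and the following invariances under conjugate transposition reduce the case of unitary
blocks in `R` to that of unitary blocks in `L`. -/
theorem IsBlockLU.conjTranspose (h : IsBlockLU c A L R) : IsBlockLU c Aᴴ Rᴴ Lᴴ where
  eq_mul := by rw [h.eq_mul, Matrix.conjTranspose_mul]
  lower i j hij := by rw [Matrix.conjTranspose_apply, h.upper j i hij, star_zero]
  upper i j hij := by rw [Matrix.conjTranspose_apply, h.lower j i hij, star_zero]

theorem HasUnitaryDiagBlocks.conjTranspose {M : Matrix (Fin n) (Fin n) 𝕜}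
    (h : HasUnitaryDiagBlocks c M) : HasUnitaryDiagBlocks c Mᴴ := fun k =>
  Unitary.star_mem (h k)

theorem schurComplement_conjTranspose (k : Fin c.length) :
    schurComplement c Aᴴ k = (schurComplement c A k)ᴴ := by
  simp only [schurComplement, Matrix.conjTranspose_sub, Matrix.conjTranspose_mul,
    Matrix.conjTranspose_nonsing_inv, ← Matrix.mul_assoc]
  rfl

theorem growthFactor_conjTranspose (hp : 1 ≤ p) :
    growthFactor c p Aᴴ = growthFactor c p A := by
  simp only [growthFactor, schurComplement_conjTranspose, schattenNorm_conjTranspose hp]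

theorem schattenCond_conjTranspose (hp : 1 ≤ p) : schattenCond p Aᴴ = schattenCond p A := by
  simp only [schattenCond, ← Matrix.conjTranspose_nonsing_inv, schattenNorm_conjTranspose hp]

theorem growthFactor_nonneg (hp : 1 ≤ p) (c : Composition n) (A : Matrix (Fin n) (Fin n) 𝕜) :
    0 ≤ growthFactor c p A :=
  div_nonneg (Real.iSup_nonneg fun _ => schattenNorm_nonneg hp _) (schattenNorm_nonneg hp _)

theorem schattenNorm_schurComplement_le (hp : 1 ≤ p) (hA : IsUnit A) (k : Fin c.length) :
    schattenNorm p (schurComplement c A k) ≤ growthFactor c p A * schattenNorm p A := by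
  have hA0 : schattenNorm p A ≠ 0 := by
    intro h0
    have hA0 : A = 0 := by
      apply Matrix.toEuclideanLin.injective
      ext1 x
      simpa [h0] using norm_toEuclideanLin_le_schattenNorm hp A x
    have : Subsingleton (Matrix (Fin n) (Fin n) 𝕜) := subsingleton_of_zero_eq_one (by
      obtain ⟨u, hu⟩ := hA
      rw [← u.mul_inv, hu, hA0, zero_mul])
    -- Blocks are nonempty, so the existence of `k` forces `n > 0` and `A = 0` cannot be invertible.
    have i : Fin n := c.embedding k ⟨0, c.one_le_blocksFun k⟩
    simpa using congrFun (congrFun (Subsingleton.elim (1 : Matrix (Fin n) (Fin n) 𝕜) 0) i) i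
  rw [growthFactor, div_mul_cancel₀ _ hA0]
  exact le_ciSup (f := fun k => schattenNorm p (schurComplement c A k))
    (Set.finite_range _).bddAbove k

theorem IsBlockLU.isUnit (hA : IsUnit A) (h : IsBlockLU c A L R) : IsUnit L ∧ IsUnit R := by
  simp only [Matrix.isUnit_iff_isUnit_det] at hA ⊢
  rwa [h.eq_mul, Matrix.det_mul, IsUnit.mul_iff] at hA

/-- The Schur complement, padded with zeros. -/
theorem IsBlockLU.selection_mul_schurComplement (hA : IsUnit A) (h : IsBlockLU c A L R)
    (k : Fin c.length) {P : Matrix (Fin n) (Fin n) 𝕜}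
    (hP : P = coordProj 𝕜 fun i => k ≤ c.index i) :
    selection 𝕜 (fun i => k ≤ c.index i) * schurComplement c A k *
      (selection 𝕜 (fun i => k ≤ c.index i))ᴴ = P * L * P * R * P := by
  obtain ⟨hL, hR⟩ := h.isUnit hA
  have hS : schurComplement c A k = L.toBlock (fun i => k ≤ c.index i) (fun i => k ≤ c.index i) *
      R.toBlock (fun i => k ≤ c.index i) (fun i => k ≤ c.index i) := by
    rw [schurComplement, h.eq_mul]
    exact schur_mul hL hR h.lower h.upper k
  rw [hP, coordProj, ← selection_mul_conjTranspose_selection, hS,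
    ← conjTranspose_selection_mul_mul_selection, ← conjTranspose_selection_mul_mul_selection]
  simp only [Matrix.mul_assoc]

theorem IsBlockLU.schattenNorm_trailing_le (hp : 1 ≤ p) (hA : IsUnit A) (h : IsBlockLU c A L R)
    (k : Fin c.length) {P : Matrix (Fin n) (Fin n) 𝕜}
    (hP : P = coordProj 𝕜 fun i => k ≤ c.index i) :
    schattenNorm p (P * L * P * R * P) ≤ growthFactor c p A * schattenNorm p A := by
  rw [← h.selection_mul_schurComplement hA k hP]
  exact (schattenNorm_mul_mul_le hp _ (isContraction_selection _)
    (isContraction_selection _).conjTranspose).trans (schattenNorm_schurComplement_le hp hA k)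

/-- `U` is the unitary block `B` padded with zeros. Its norm is estimated through `B`, so that the
block size enters and not `n`. -/
theorem HasUnitaryDiagBlocks.coordProj_mul_mul (h : HasUnitaryDiagBlocks c L) (k : Fin c.length)
    {E U : Matrix (Fin n) (Fin n) 𝕜} (hE : E = coordProj 𝕜 fun i => c.index i = k)
    (hU : U = E * L * E) :
    Uᴴ * U = E ∧ IsContraction U ∧
      ∀ p, 1 ≤ p → schattenNorm p U ≤ (maxBlockSize c : ℝ) ^ (1 / p).toReal := by
  set C : Matrix (Fin n) {i // c.index i = k} 𝕜 := selection 𝕜 (fun i => c.index i = k) with hC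
  set B := L.toSquareBlock c.index k with hB
  have hBB : Bᴴ * B = 1 := (Matrix.mem_unitaryGroup_iff').1 (h k)
  have hCC : Cᴴ * C = 1 := conjTranspose_selection_mul_selection _
  have hUB : U = C * B * Cᴴ := by
    have : B = Cᴴ * L * C := (conjTranspose_selection_mul_mul_selection _ _ L).symm
    rw [hU, hE, coordProj, ← selection_mul_conjTranspose_selection, this]
    simp only [Matrix.mul_assoc, hC]
  have hCc : IsContraction C := isContraction_selection _
  have hBc : IsContraction B := isContraction_of_conjTranspose_mul_self hBB
  refine ⟨?_, ?_, fun p hp => ?_⟩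
  · calc Uᴴ * U = C * (Bᴴ * (Cᴴ * C) * B) * Cᴴ := by
          rw [hUB]
          simp only [Matrix.conjTranspose_mul, Matrix.conjTranspose_conjTranspose,
            Matrix.mul_assoc]
      _ = E := by
          rw [hCC, Matrix.mul_one, hBB, Matrix.mul_one, hE, coordProj,
            ← selection_mul_conjTranspose_selection]
  · rw [hUB]
    exact (hCc.mul hBc).mul hCc.conjTranspose
  · rw [hUB]
    refine (schattenNorm_mul_mul_le hp B hCc hCc.conjTranspose).trans
      ((hBc.schattenNorm_le hp).trans ?_)
    gcongr
    exact card_block_le c k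

theorem IsBlockLU.schattenNorm_upper_le (hp : 1 ≤ p) (hA : IsUnit A) (h : IsBlockLU c A L R)
    (hL : HasUnitaryDiagBlocks c L) :
    schattenNorm p R ≤ (c.length : ℝ) * growthFactor c p A * schattenNorm p A := by
  have hrow : ∀ k, schattenNorm p (coordProj 𝕜 (fun i => c.index i = k) * R) ≤
      growthFactor c p A * schattenNorm p A := by
    intro k
    obtain ⟨hUU, hU, -⟩ := hL.coordProj_mul_mul k rfl rfl
    rw [← coordProj_mul_upper h.lower h.upper k rfl rfl rfl hUU]
    have hI : IsContraction (1 : Matrix (Fin n) (Fin n) 𝕜) :=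
      isContraction_of_conjTranspose_mul_self (by simp)
    refine le_trans ?_ (h.schattenNorm_trailing_le hp hA k rfl)
    simpa only [Matrix.mul_one] using schattenNorm_mul_mul_le hp _ hU.conjTranspose hI
  calc schattenNorm p R
      = schattenNorm p (∑ k, coordProj 𝕜 (fun i => c.index i = k) * R) := by
        rw [← Finset.sum_mul, sum_coordProj_index, Matrix.one_mul]
    _ ≤ ∑ k, schattenNorm p (coordProj 𝕜 (fun i => c.index i = k) * R) :=
        schattenNorm_sum_le hp _ _
    _ ≤ ∑ _k : Fin c.length, growthFactor c p A * schattenNorm p A :=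
        Finset.sum_le_sum fun k _ => hrow k
    _ = _ := by simp [mul_assoc]

theorem IsBlockLU.schattenNorm_lower_le (hp : 1 ≤ p) (hA : IsUnit A) (h : IsBlockLU c A L R)
    (hL : HasUnitaryDiagBlocks c L) :
    schattenNorm p L ≤ (maxBlockSize c : ℝ) ^ (1 / p).toReal * (c.length : ℝ) +
      (c.length : ℝ) * growthFactor c p A * schattenCond p A := by
  obtain ⟨hLu, hRu⟩ := h.isUnit hA
  have htrail : ∀ k : Fin c.length, ∀ P : Matrix (Fin n) (Fin n) 𝕜,
      P = coordProj 𝕜 (fun i => k < c.index i) →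
      schattenNorm p (P * L * P * R * P) ≤ growthFactor c p A * schattenNorm p A := by
    intro k P hP
    -- The blocks strictly after `k` are those from `k + 1` on, which gives the next Schur
    -- complement; after the last block nothing is left and `P = 0`.
    by_cases hk : (k : ℕ) + 1 < c.length
    · refine h.schattenNorm_trailing_le hp hA ⟨k + 1, hk⟩ ?_
      rw [hP]
      congr 1
    · have hP0 : P = 0 := by
        rw [hP]
        ext i j
        have : ¬ k < c.index i := fun hlt => hk (by have := (c.index i).2; omega)
        simp [coordProj, Matrix.diagonal_apply, this]
      rw [hP0, Matrix.mul_zero, schattenNorm_zero hp]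
      exact mul_nonneg (growthFactor_nonneg hp c A) (schattenNorm_nonneg hp A)
  have hcol : ∀ k, schattenNorm p (L * coordProj 𝕜 (fun i => c.index i = k)) ≤
      (maxBlockSize c : ℝ) ^ (1 / p).toReal + growthFactor c p A * schattenCond p A := by
    intro k
    obtain ⟨-, hU, hUn⟩ := hL.coordProj_mul_mul k rfl rfl
    rw [lower_mul_coordProj hLu hRu h.lower h.upper k rfl rfl, ← h.eq_mul]
    refine (schattenNorm_add_le hp _ _).trans (add_le_add (hUn p hp) ?_)
    rw [schattenNorm_neg hp]
    have hI : IsContraction (1 : Matrix (Fin n) (Fin n) 𝕜) :=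
      isContraction_of_conjTranspose_mul_self (by simp)
    -- The contraction `U` is removed first; then `A⁻¹` enters through its spectral norm, which its
    -- Schatten norm dominates.
    have h1 := schattenNorm_mul_mul_le hp (coordProj 𝕜 (fun i => k < c.index i) * L *
      coordProj 𝕜 (fun i => k < c.index i) * R * coordProj 𝕜 (fun i => k < c.index i) * A⁻¹) hI hU
    rw [Matrix.one_mul] at h1
    refine h1.trans ((schattenNorm_mul_le hp _ (schattenNorm_nonneg hp A⁻¹)
      (norm_toEuclideanLin_le_schattenNorm hp A⁻¹)).trans ?_)
    rw [schattenCond, ← mul_assoc]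
    exact mul_le_mul_of_nonneg_right (htrail k _ rfl) (schattenNorm_nonneg hp _)
  calc schattenNorm p L
      = schattenNorm p (∑ k, L * coordProj 𝕜 (fun i => c.index i = k)) := by
        rw [← Finset.mul_sum, sum_coordProj_index, Matrix.mul_one]
    _ ≤ ∑ k, schattenNorm p (L * coordProj 𝕜 (fun i => c.index i = k)) :=
        schattenNorm_sum_le hp _ _
    _ ≤ ∑ _k : Fin c.length,
        ((maxBlockSize c : ℝ) ^ (1 / p).toReal + growthFactor c p A * schattenCond p A) :=
        Finset.sum_le_sum fun k _ => hcol k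
    _ = _ := by
        simp only [Finset.sum_const, Finset.card_univ, Fintype.card_fin, nsmul_eq_mul]
        ring

/-- The three bounds for a factorization whose lower triangular factor has unitary diagonal
blocks. -/
theorem IsBlockLU.schattenNorm_bounds (hp : 1 ≤ p) (hA : IsUnit A) (h : IsBlockLU c A L R)
    (hL : HasUnitaryDiagBlocks c L) :
    schattenNorm p L ≤ (maxBlockSize c : ℝ) ^ (1 / p).toReal * (c.length : ℝ) +
        (c.length : ℝ) * growthFactor c p A * schattenCond p A ∧
      schattenNorm p R ≤ (c.length : ℝ) * growthFactor c p A * schattenNorm p A ∧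
      schattenNorm p L * schattenNorm p R ≤
        (c.length : ℝ) ^ 2 * growthFactor c p A ^ 2 * schattenCond p A * schattenNorm p A +
          (maxBlockSize c : ℝ) ^ (1 / p).toReal * (c.length : ℝ) ^ 2 *
            growthFactor c p A * schattenNorm p A := by
  have h1 := h.schattenNorm_lower_le hp hA hL
  have h2 := h.schattenNorm_upper_le hp hA hL
  have h3 := mul_le_mul h1 h2 (schattenNorm_nonneg hp R) ((schattenNorm_nonneg hp L).trans h1)
  refine ⟨h1, h2, h3.trans (le_of_eq ?_)⟩
  ring

end Bounds

end BlockLU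

end

theorem mainTheorem1 {𝕜 : Type*} [RCLike 𝕜] {n : ℕ} (c : Composition n)
    (A L R : Matrix (Fin n) (Fin n) 𝕜) (hA : IsUnit A) (hLR : BlockLU.IsBlockLU c A L R)
    (p : ℝ≥0∞) (hp : 1 ≤ p) :
    (BlockLU.HasUnitaryDiagBlocks c L →
      BlockLU.schattenNorm p L ≤
          (BlockLU.maxBlockSize c : ℝ) ^ (1 / p).toReal * (c.length : ℝ) +
            (c.length : ℝ) * BlockLU.growthFactor c p A * BlockLU.schattenCond p A ∧
        BlockLU.schattenNorm p R ≤
          (c.length : ℝ) * BlockLU.growthFactor c p A * BlockLU.schattenNorm p A ∧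
        BlockLU.schattenNorm p L * BlockLU.schattenNorm p R ≤
          (c.length : ℝ) ^ 2 * BlockLU.growthFactor c p A ^ 2 * BlockLU.schattenCond p A *
              BlockLU.schattenNorm p A +
            (BlockLU.maxBlockSize c : ℝ) ^ (1 / p).toReal * (c.length : ℝ) ^ 2 *
              BlockLU.growthFactor c p A * BlockLU.schattenNorm p A) ∧
    (BlockLU.HasUnitaryDiagBlocks c R →
      BlockLU.schattenNorm p R ≤
          (BlockLU.maxBlockSize c : ℝ) ^ (1 / p).toReal * (c.length : ℝ) +
            (c.length : ℝ) * BlockLU.growthFactor c p A * BlockLU.schattenCond p A ∧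
        BlockLU.schattenNorm p L ≤
          (c.length : ℝ) * BlockLU.growthFactor c p A * BlockLU.schattenNorm p A ∧
        BlockLU.schattenNorm p L * BlockLU.schattenNorm p R ≤
          (c.length : ℝ) ^ 2 * BlockLU.growthFactor c p A ^ 2 * BlockLU.schattenCond p A *
              BlockLU.schattenNorm p A +
            (BlockLU.maxBlockSize c : ℝ) ^ (1 / p).toReal * (c.length : ℝ) ^ 2 *
              BlockLU.growthFactor c p A * BlockLU.schattenNorm p A) := by
  refine ⟨hLR.schattenNorm_bounds hp hA, fun hR => ?_⟩
  -- `Aᴴ = Rᴴ Lᴴ` is a block LU factorization whose lower factor `Rᴴ` has unitary diagonal blocks.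
  have hA' : IsUnit A.conjTranspose := (Matrix.isUnit_conjTranspose A).2 hA
  have h := hLR.conjTranspose.schattenNorm_bounds hp hA' hR.conjTranspose
  simp only [BlockLU.schattenNorm_conjTranspose hp, BlockLU.growthFactor_conjTranspose hp,
    BlockLU.schattenCond_conjTranspose hp] at h
  refine ⟨h.1, h.2.1, ?_⟩
  rw [mul_comm (BlockLU.schattenNorm p L)]
  exact h.2.2
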